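/- A signed graph $\Gamma=(G,\sigma)$ consists of a finite simple graph $G=(V,E)$ and a map $\sigma:E\to\{+1,-1\}$. Its adjacency matrix is the real matrix indexed by $V$ whose $(u,v)$ entry is $\sigma(uv)$ if $uv\in E$ and $0$ otherwise, and its nullity $\eta(\Gamma)$ is the multiplicity of $0$ as an eigenvalue of this matrix. Call $\Gamma$ unicyclic if $G$ is connected and contains exactly one cycle. For $r\ge 1$ let $U_4(r)$ be the graph obtained from a triangle and a star $K_{1,r+1}$ by identifying one vertex of the triangle with a pendant vertex of the star. Theorem. Let $\Gamma=(G,\sigma)$ be a unicyclic signed graph of order $n\ge 5$. Then $\eta(\Gamma)=n-5$ if and only if $G$ is isomorphic to the cycle $C_5$ or to $U_4(r)$ for some $r\ge 1$ (in both cases with an arbitrary signing $\sigma$). -/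

import Mathlib

/-- A signed graph: a simple graph with a sign attached to each of its edges
(`ℤˣ = {1, -1}`). -/
structure SignedGraph (V : Type*) where
  /-- the underlying simple graph -/
  graph : SimpleGraph V
  /-- the edge labelling -/
  sign : graph.edgeSet → ℤˣ

namespace SignedGraph

variable {V : Type*}

open Classical in
/-- The adjacency matrix: the `(u, v)` entry is the sign of `uv` if `uv` is an edge, and `0`
otherwise. -/
noncomputable def adjMatrix (Γ : SignedGraph V) : Matrix V V ℝ :=
  Matrix.of fun u v =>
    if h : Γ.graph.Adj u v then
      (((Γ.sign ⟨s(u, v), (SimpleGraph.mem_edgeSet Γ.graph).mpr h⟩ : ℤˣ) : ℤ) : ℝ)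
    else 0

/-- The nullity: the multiplicity of the eigenvalue `0` in the spectrum of the adjacency
matrix. -/
noncomputable def nullity [Fintype V] [DecidableEq V] (Γ : SignedGraph V) : ℕ :=
  Γ.adjMatrix.charpoly.rootMultiplicity 0

end SignedGraph

namespace SimpleGraph

/-- A subgraph is a cycle if it consists of the vertices and edges of a closed walk that is a
cycle. -/
def Subgraph.IsCycleSubgraph {V : Type*} {G : SimpleGraph V} (H : G.Subgraph) : Prop :=
  ∃ (v : V) (c : G.Walk v v), c.IsCycle ∧ c.toSubgraph = H

/-- A graph is unicyclic if it is connected and contains exactly one cycle. -/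
def IsUnicyclic {V : Type*} (G : SimpleGraph V) : Prop :=
  G.Connected ∧ ∃! H : G.Subgraph, H.IsCycleSubgraph

/-- The graph obtained from disjoint copies of `G` and `H` by identifying the vertex `u` of `G`
with the vertex `w` of `H`; the identified vertex is represented by `Sum.inl u`. -/
def identifyVertex {V W : Type*} (G : SimpleGraph V) (H : SimpleGraph W) (u : V) (w : W) :
    SimpleGraph (V ⊕ {x : W // x ≠ w}) where
  Adj
    | Sum.inl a, Sum.inl b => G.Adj a b
    | Sum.inl a, Sum.inr y => a = u ∧ H.Adj w y
    | Sum.inr x, Sum.inl b => b = u ∧ H.Adj w x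
    | Sum.inr x, Sum.inr y => H.Adj x y
  symm := ⟨by
    rintro (a | x) (b | y) h
    · exact SimpleGraph.Adj.symm h
    · exact h
    · exact h
    · exact SimpleGraph.Adj.symm h⟩
  loopless := ⟨by
    rintro (a | x) h
    · exact G.loopless.irrefl a h
    · exact H.loopless.irrefl _ h⟩

/-- The graph `U₄(r)`: a triangle one of whose vertices is identified with a pendant vertex of
the star `K_{1,r+1}` (the star on `Fin (r + 2)` with centre `0`). -/
def U4 (r : ℕ) : SimpleGraph (Fin 3 ⊕ {x : Fin (r + 2) // x ≠ 1}) :=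
  identifyVertex (completeGraph (Fin 3)) (starGraph (0 : Fin (r + 2))) 0 1

end SimpleGraph

/-! ### Rank of real matrices. -/

namespace Matrix

variable {V : Type*} [Fintype V]

/-! A real symmetric matrix has nullity order minus rank, so the question is which unicyclic signed
graphs have rank 5. Only the zero pattern of the matrix matters: every bound below holds for
arbitrary nonzero symmetric weights on the edges, so the signing plays no role. Lower bounds come
from nonsingular induced subgraphs (`le_rank_of_pattern`), upper bounds from covering the edges by
few rows and columns (`rank_le_of_cover`).

If the cycle is even, the graph is bipartite and the rank is even (`even_rank_of_bipartite`). If it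
has length at least 7, it contains an induced path on six vertices, of rank 6. So the length is 3 or
5. A vertex outside a pentagon yields a pendant vertex on it and rank 6, which leaves `C₅`. For a
triangle, suppose first that a path of length two leaves it: any deviation from `U4 r` induces one
of three kinds of rank-six graph (`exists_iso_U4_of_tail`). Otherwise all remaining vertices hang
directly on the triangle, and the rank is at most 4 or at least 6 (`rank_ne_five_of_no_tail`). -/

theorem rank_add_le_rank_add_rank (A B : Matrix V V ℝ) : (A + B).rank ≤ A.rank + B.rank := by
  unfold Matrix.rank
  rw [Matrix.mulVecLin_add]
  refine le_trans (Submodule.finrank_mono (t := LinearMap.range A.mulVecLin ⊔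
    LinearMap.range B.mulVecLin) ?_) (Submodule.finrank_add_le_finrank_add_finrank _ _)
  rintro _ ⟨x, rfl⟩
  exact Submodule.add_mem_sup ⟨x, rfl⟩ ⟨x, rfl⟩

/-- Injectivity of `f` need not be assumed: a repeated index gives two equal columns, which the
trivial kernel excludes. -/
theorem le_rank_of_submatrix_mulVec (A : Matrix V V ℝ) {k : ℕ} (f : Fin k → V)
    (h : ∀ x : Fin k → ℝ, (A.submatrix f f) *ᵥ x = 0 → x = 0) : k ≤ A.rank := by
  have hdet : (A.submatrix f f).det ≠ 0 := by
    intro h0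
    obtain ⟨x, hx, hx0⟩ := Matrix.exists_mulVec_eq_zero_iff.mpr h0
    exact hx (h x hx0)
  have := rank_submatrix_le A f f
  rw [rank_of_det_ne_zero hdet] at this
  simpa using this

variable [DecidableEq V]

/-- By diagonalisation, the roots of the characteristic polynomial are the eigenvalues, and the rank
counts the nonzero ones. -/
theorem IsHermitian.rootMultiplicity_zero_charpoly_add_rank {A : Matrix V V ℝ}
    (hA : A.IsHermitian) :
    A.charpoly.rootMultiplicity 0 + A.rank = Fintype.card V := by
  rw [hA.rank_eq_card_non_zero_eigs, ← Polynomial.count_roots,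
    hA.roots_charpoly_eq_eigenvalues, Multiset.count_map, Fintype.card_subtype_compl]
  have h : Multiset.card (Multiset.filter
      (fun a => (0 : ℝ) = ((RCLike.ofReal ∘ hA.eigenvalues) a : ℝ)) (Finset.univ : Finset V).val)
      = Fintype.card {i // hA.eigenvalues i = 0} := by
    rw [Fintype.card_subtype, Finset.card_def, Finset.filter_val]
    congr 1
    refine Multiset.filter_congr fun i _ => ?_
    simp [eq_comm]
  have hle := Fintype.card_subtype_le fun i => hA.eigenvalues i = 0
  rw [h]
  omega

/-- If every nonzero entry of `A` lies in a row from `S`, a column from `S` or a row from `T`,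
then the rank of `A` is at most `2|S| + |T|`. -/
theorem rank_le_of_cover (A : Matrix V V ℝ) (S T : Finset V)
    (h : ∀ u v, A u v ≠ 0 → u ∈ S ∨ v ∈ S ∨ u ∈ T) :
    A.rank ≤ 2 * S.card + T.card := by
  -- Split `A` into the rows in `S`, the columns in `S` outside those rows, and a remainder whose
  -- nonzero rows lie in `T`.
  set R : Matrix V V ℝ := Matrix.of fun u v => if u ∈ S then A u v else 0
  set C : Matrix V V ℝ := Matrix.of fun u v => if u ∉ S ∧ v ∈ S then A u v else 0
  set M : Matrix V V ℝ := Matrix.of fun u v => if u ∉ S ∧ v ∉ S then A u v else 0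
  have hA : A = (R + C) + M := by
    ext u v
    by_cases hu : u ∈ S <;> by_cases hv : v ∈ S <;> simp [R, C, M, hu, hv]
  have h1 : R.rank ≤ S.card := by
    refine rank_le_card_of_support_subset R S fun u hu => ?_
    by_contra hS
    apply hu
    ext v
    have : u ∉ S := by simpa using hS
    simp [R, Matrix.row, this]
  have h2 : C.rank ≤ S.card := by
    rw [← rank_transpose]
    refine rank_le_card_of_support_subset Cᵀ S fun u hu => ?_
    by_contra hS
    apply hu
    ext v
    have : u ∉ S := by simpa using hS
    simp [C, Matrix.row, this]
  have h3 : M.rank ≤ T.card := by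
    refine rank_le_card_of_support_subset M T fun u hu => ?_
    by_contra hT
    apply hu
    ext v
    have hT' : u ∉ T := by simpa using hT
    by_cases hc : u ∉ S ∧ v ∉ S
    · have : A u v = 0 := by
        by_contra h0
        rcases h u v h0 with h | h | h <;> tauto
      simp [M, Matrix.row, this]
    · simp [M, Matrix.row, hc]
  have h4 := rank_add_le_rank_add_rank (R + C) M
  have h5 := rank_add_le_rank_add_rank R C
  rw [hA]
  omega

/-- A symmetric matrix whose support is bipartite has even rank. -/
theorem even_rank_of_bipartite {A : Matrix V V ℝ} (hA : Aᵀ = A) (f : V → Bool)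
    (h : ∀ u v, f u = f v → A u v = 0) : Even A.rank := by
  -- `E` and `F` project onto the two colour classes, and `A` exchanges them. Thus `E * A` and `F *
  -- A` are transposes of each other, and the range of `A` is the direct sum of theirs.
  set E : Matrix V V ℝ := diagonal fun v => if f v then 1 else 0 with hE
  set F : Matrix V V ℝ := diagonal fun v => if f v then 0 else 1 with hF
  have hEA : E * A = A * F := by
    ext u v
    have := h u v
    rw [hE, hF, diagonal_mul, mul_diagonal]
    cases hu : f u <;> cases hv : f v <;> simp_all
  have hFA : F * A = A * E := by
    ext u v
    have := h u v
    rw [hE, hF, diagonal_mul, mul_diagonal]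
    cases hu : f u <;> cases hv : f v <;> simp_all
  have hsum : E + F = 1 := by
    rw [hE, hF, diagonal_add, ← diagonal_one]
    congr 1
    ext v
    cases f v <;> simp
  have hEF : E * F = 0 := by
    rw [hE, hF, diagonal_mul_diagonal, ← diagonal_zero]
    congr 1
    ext v
    cases f v <;> simp
  have hEE : E * E = E := by
    rw [hE, diagonal_mul_diagonal]
    congr 1
    ext v
    cases f v <;> simp
  have hrank : (E * A).rank = (F * A).rank := by
    rw [← rank_transpose, transpose_mul, hA, hFA, hE, diagonal_transpose]
  have hsup : LinearMap.range A.mulVecLin =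
      LinearMap.range (E * A).mulVecLin ⊔ LinearMap.range (F * A).mulVecLin := by
    apply le_antisymm
    · rintro _ ⟨x, rfl⟩
      have : A.mulVecLin x = (E * A).mulVecLin x + (F * A).mulVecLin x := by
        rw [← LinearMap.add_apply, ← mulVecLin_add, ← add_mul, hsum, one_mul]
      rw [this]
      exact Submodule.add_mem_sup ⟨x, rfl⟩ ⟨x, rfl⟩
    · refine sup_le ?_ ?_
      · rw [hEA, mulVecLin_mul]
        exact LinearMap.range_comp_le_range _ _
      · rw [hFA, mulVecLin_mul]
        exact LinearMap.range_comp_le_range _ _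
  have hinf : LinearMap.range (E * A).mulVecLin ⊓ LinearMap.range (F * A).mulVecLin = ⊥ := by
    rw [eq_bot_iff]
    rintro z ⟨⟨x, hx⟩, ⟨y, hy⟩⟩
    have h1 : E *ᵥ z = z := by
      rw [← hx, mulVecLin_apply, mulVec_mulVec, ← mul_assoc, hEE]
    have h2 : E *ᵥ z = 0 := by
      rw [← hy, mulVecLin_apply, mulVec_mulVec, ← mul_assoc, hEF, zero_mul, zero_mulVec]
    exact (Submodule.mem_bot ℝ).mpr (h1.symm.trans h2)
  have key := Submodule.finrank_sup_add_finrank_inf_eq (LinearMap.range (E * A).mulVecLin)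
    (LinearMap.range (F * A).mulVecLin)
  rw [hinf, finrank_bot, ← hsup] at key
  change A.rank + 0 = (E * A).rank + (F * A).rank at key
  exact ⟨(F * A).rank, by omega⟩

end Matrix

/-! ### The signed adjacency matrix and its nullity. -/

namespace SignedGraph

variable {V : Type*} (Γ : SignedGraph V)

theorem adjMatrix_eq_zero {u v : V} (h : ¬ Γ.graph.Adj u v) : Γ.adjMatrix u v = 0 := by
  simp [adjMatrix, h]

theorem adjMatrix_ne_zero {u v : V} (h : Γ.graph.Adj u v) : Γ.adjMatrix u v ≠ 0 := by
  simp [adjMatrix, h]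

theorem adjMatrix_symm (u v : V) : Γ.adjMatrix u v = Γ.adjMatrix v u := by
  by_cases h : Γ.graph.Adj u v
  · simp only [adjMatrix, Matrix.of_apply, h, h.symm, dite_true]
    have : (⟨s(u, v), h⟩ : Γ.graph.edgeSet) = ⟨s(v, u), h.symm⟩ := Subtype.ext Sym2.eq_swap
    rw [this]
  · rw [adjMatrix_eq_zero Γ h, adjMatrix_eq_zero Γ fun h' => h h'.symm]

theorem adjMatrix_transpose : Γ.adjMatrix.transpose = Γ.adjMatrix := by
  ext u v
  exact Γ.adjMatrix_symm v u

variable [Fintype V] [DecidableEq V]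

theorem nullity_add_rank : Γ.nullity + Γ.adjMatrix.rank = Fintype.card V :=
  Matrix.IsHermitian.rootMultiplicity_zero_charpoly_add_rank (by
    rw [Matrix.IsHermitian, Matrix.conjTranspose_eq_transpose_of_trivial, adjMatrix_transpose])

/-- The bound `hn` keeps the natural-number subtraction from truncating. -/
theorem nullity_eq_card_sub_five_iff (hn : 5 ≤ Fintype.card V) :
    Γ.nullity = Fintype.card V - 5 ↔ Γ.adjMatrix.rank = 5 := by
  have := Γ.nullity_add_rank
  omega

end SignedGraph

/-! ### Lower bounds on the rank from induced subgraphs. -/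

namespace SimpleGraph

/-- The vertices `f 0, …, f (k - 1)` induce the graph whose edges `ij`, `i < j`, are listed
in `l`. -/
def InducesPattern {V : Type*} (G : SimpleGraph V) {k : ℕ} (f : Fin k → V)
    (l : List (Fin k × Fin k)) : Prop :=
  ∀ i j, i < j → (G.Adj (f i) (f j) ↔ (i, j) ∈ l)

end SimpleGraph

namespace SignedGraph

variable {V : Type*} {Γ : SignedGraph V}

theorem adjMatrix_self (v : V) : Γ.adjMatrix v v = 0 :=
  Γ.adjMatrix_eq_zero (Γ.graph.irrefl)

theorem adjMatrix_pattern_eq_zero {k : ℕ} {f : Fin k → V} {l : List (Fin k × Fin k)}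
    (hf : Γ.graph.InducesPattern f l) (i j : Fin k) (hij : i < j) (h : (i, j) ∉ l) :
    Γ.adjMatrix (f i) (f j) = 0 :=
  Γ.adjMatrix_eq_zero fun h' => h ((hf i j hij).mp h')

theorem adjMatrix_pattern_ne_zero {k : ℕ} {f : Fin k → V} {l : List (Fin k × Fin k)}
    (hf : Γ.graph.InducesPattern f l) (hl : ∀ e ∈ l, e.1 < e.2) :
    ∀ e ∈ l, Γ.adjMatrix (f e.1) (f e.2) ≠ 0 :=
  fun e he => Γ.adjMatrix_ne_zero ((hf e.1 e.2 (hl e he)).mpr he)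

/-- Each edge weight is written with the smaller index first, so that for a concrete `l`
simplification leaves linear equations with one symbol per edge. -/
theorem mulVec_pattern_apply {k : ℕ} {f : Fin k → V} {l : List (Fin k × Fin k)}
    (hf : Γ.graph.InducesPattern f l) (x : Fin k → ℝ) (i : Fin k) :
    ((Γ.adjMatrix.submatrix f f).mulVec x) i =
      ∑ j, (if (i, j) ∈ l ∧ i < j then Γ.adjMatrix (f i) (f j)
        else if (j, i) ∈ l ∧ j < i then Γ.adjMatrix (f j) (f i) else 0) * x j := by
  rw [Matrix.mulVec, dotProduct]
  refine Finset.sum_congr rfl fun j _ => ?_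
  rw [Matrix.submatrix_apply]
  congr 1
  split_ifs with h1 h2
  · rfl
  · exact Γ.adjMatrix_symm _ _
  · rcases lt_trichotomy i j with h | rfl | h
    · exact adjMatrix_pattern_eq_zero hf i j h fun h' => h1 ⟨h', h⟩
    · exact adjMatrix_self _
    · rw [adjMatrix_symm]
      exact adjMatrix_pattern_eq_zero hf j i h fun h' => h2 ⟨h', h⟩

/-- The determinant is `2 * p * q * r`: both orientations of an odd cycle contribute with the same
sign, so no choice of weights makes them cancel. The pentagon behaves likewise. -/
theorem triangle_system {p q r x y z : ℝ} (hp : p ≠ 0) (hq : q ≠ 0) (hr : r ≠ 0)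
    (h0 : p * y + q * z = 0) (h1 : p * x + r * z = 0) (h2 : q * x + r * y = 0) :
    x = 0 ∧ y = 0 ∧ z = 0 := by
  have hx : x = 0 := by
    have : 2 * p * q * x = 0 := by linear_combination q * h1 + p * h2 - r * h0
    simpa [hp, hq] using this
  subst hx
  simp_all

theorem pentagon_system {p q r s t x0 x1 x2 x3 x4 : ℝ} (hp : p ≠ 0) (hq : q ≠ 0) (hr : r ≠ 0)
    (hs : s ≠ 0) (ht : t ≠ 0) (h0 : p * x1 + t * x4 = 0) (h1 : p * x0 + q * x2 = 0)
    (h2 : q * x1 + r * x3 = 0) (h3 : r * x2 + s * x4 = 0) (h4 : t * x0 + s * x3 = 0) :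
    x0 = 0 ∧ x1 = 0 ∧ x2 = 0 ∧ x3 = 0 ∧ x4 = 0 := by
  have hx : x1 = 0 := by
    have : 2 * q * s * p * x1 = 0 := by
      linear_combination -q * t * h3 + q * s * h0 + t * r * h1 - r * p * h4 + p * s * h2
    simpa [hp, hq, hs] using this
  subst hx
  simp_all

variable [Fintype V]

/-- In the patterns with a leaf, the leaf's equation kills the coordinate of its neighbour; back
substitution, with `triangle_system` once, kills the rest. -/
theorem le_rank_of_pattern {k : ℕ} {f : Fin k → V} {l : List (Fin k × Fin k)}
    (hf : Γ.graph.InducesPattern f l) (hl : ∀ e ∈ l, e.1 < e.2)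
    (h : ∀ x : Fin k → ℝ, (∀ e ∈ l, Γ.adjMatrix (f e.1) (f e.2) ≠ 0) →
      (∀ i, ∑ j, (if (i, j) ∈ l ∧ i < j then Γ.adjMatrix (f i) (f j)
        else if (j, i) ∈ l ∧ j < i then Γ.adjMatrix (f j) (f i) else 0) * x j = 0) → x = 0) :
    k ≤ Γ.adjMatrix.rank :=
  Matrix.le_rank_of_submatrix_mulVec _ f fun x hx =>
    h x (adjMatrix_pattern_ne_zero hf hl) fun i =>
      (mulVec_pattern_apply hf x i).symm.trans (congrFun hx i)

/-- A pentagon has rank five. -/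
theorem five_le_rank_of_pentagon {f : Fin 5 → V}
    (hf : Γ.graph.InducesPattern f [(0, 1), (1, 2), (2, 3), (3, 4), (0, 4)]) :
    5 ≤ Γ.adjMatrix.rank := by
  refine le_rank_of_pattern hf (by decide) fun x n h => ?_
  simp [Fin.forall_fin_succ, Fin.sum_univ_succ] at n h
  obtain ⟨n01, n12, n23, n34, n04⟩ := n
  obtain ⟨h0, h1, h2, h3, h4⟩ := h
  obtain ⟨e0, e1, e2, e3, e4⟩ := pentagon_system n01 n12 n23 n34 n04 h0 h1 h2 h3 h4
  ext i
  fin_cases i <;> simp [*]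

/-- A triangle with a path of length two attached has rank five. -/
theorem five_le_rank_of_triangle_tail {f : Fin 5 → V}
    (hf : Γ.graph.InducesPattern f [(0, 1), (0, 2), (1, 2), (0, 3), (3, 4)]) :
    5 ≤ Γ.adjMatrix.rank := by
  refine le_rank_of_pattern hf (by decide) fun x n h => ?_
  simp [Fin.forall_fin_succ, Fin.sum_univ_succ] at n h
  obtain ⟨n01, n02, n12, n03, n34⟩ := n
  obtain ⟨h0, h1, h2, h3, h4⟩ := h
  have e3 : x 3 = 0 := by simpa [n34] using h4
  obtain ⟨e0, e1, e2⟩ := triangle_system n01 n02 n12 (by simpa [e3] using h0) h1 h2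
  have e4 : x 4 = 0 := by simpa [e0, n34] using h3
  ext i
  fin_cases i <;> simp [*]

/-- A path on six vertices has rank six. -/
theorem six_le_rank_of_path {f : Fin 6 → V}
    (hf : Γ.graph.InducesPattern f [(0, 1), (1, 2), (2, 3), (3, 4), (4, 5)]) :
    6 ≤ Γ.adjMatrix.rank := by
  refine le_rank_of_pattern hf (by decide) fun x n h => ?_
  simp [Fin.forall_fin_succ, Fin.sum_univ_succ] at n h
  obtain ⟨n01, n12, n23, n34, n45⟩ := n
  obtain ⟨h0, h1, h2, h3, h4, h5⟩ := h
  have e1 : x 1 = 0 := by simpa [n01] using h0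
  have e3 : x 3 = 0 := by simpa [e1, n23] using h2
  have e5 : x 5 = 0 := by simpa [e3, n45] using h4
  have e4 : x 4 = 0 := by simpa [n45] using h5
  have e2 : x 2 = 0 := by simpa [e4, n23] using h3
  have e0 : x 0 = 0 := by simpa [e2, n01] using h1
  ext i
  fin_cases i <;> simp [*]

/-- A pentagon with a pendant vertex has rank six. -/
theorem six_le_rank_of_pentagon_pendant {f : Fin 6 → V}
    (hf : Γ.graph.InducesPattern f [(0, 1), (1, 2), (2, 3), (3, 4), (0, 4), (0, 5)]) :
    6 ≤ Γ.adjMatrix.rank := by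
  refine le_rank_of_pattern hf (by decide) fun x n h => ?_
  simp [Fin.forall_fin_succ, Fin.sum_univ_succ] at n h
  obtain ⟨n01, n12, n23, n34, n04, n05⟩ := n
  obtain ⟨h0, h1, h2, h3, h4, h5⟩ := h
  have e0 : x 0 = 0 := by simpa [n05] using h5
  have e2 : x 2 = 0 := by simpa [e0, n12] using h1
  have e3 : x 3 = 0 := by simpa [e0, n34] using h4
  have e1 : x 1 = 0 := by simpa [e3, n12] using h2
  have e4 : x 4 = 0 := by simpa [e2, n34] using h3
  have e5 : x 5 = 0 := by simpa [e1, e4, n05] using h0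
  ext i
  fin_cases i <;> simp [*]

/-- A triangle with a pendant vertex at each of its vertices has rank six. -/
theorem six_le_rank_of_net {f : Fin 6 → V}
    (hf : Γ.graph.InducesPattern f [(0, 1), (0, 2), (1, 2), (0, 3), (1, 4), (2, 5)]) :
    6 ≤ Γ.adjMatrix.rank := by
  refine le_rank_of_pattern hf (by decide) fun x n h => ?_
  simp [Fin.forall_fin_succ, Fin.sum_univ_succ] at n h
  obtain ⟨n01, n02, n12, n03, n14, n25⟩ := n
  obtain ⟨h0, h1, h2, h3, h4, h5⟩ := h
  have e0 : x 0 = 0 := by simpa [n03] using h3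
  have e1 : x 1 = 0 := by simpa [n14] using h4
  have e2 : x 2 = 0 := by simpa [n25] using h5
  have e3 : x 3 = 0 := by simpa [e1, e2, n03] using h0
  have e4 : x 4 = 0 := by simpa [e0, e2, n14] using h1
  have e5 : x 5 = 0 := by simpa [e0, e1, n25] using h2
  ext i
  fin_cases i <;> simp [*]

/-- A triangle with a path of length two and a pendant vertex attached at the same vertex has
rank six. -/
theorem six_le_rank_of_triangle_tail_pendant {f : Fin 6 → V}
    (hf : Γ.graph.InducesPattern f [(0, 1), (0, 2), (1, 2), (0, 3), (3, 4), (0, 5)]) :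
    6 ≤ Γ.adjMatrix.rank := by
  refine le_rank_of_pattern hf (by decide) fun x n h => ?_
  simp [Fin.forall_fin_succ, Fin.sum_univ_succ] at n h
  obtain ⟨n01, n02, n12, n03, n34, n05⟩ := n
  obtain ⟨h0, h1, h2, h3, h4, h5⟩ := h
  have e0 : x 0 = 0 := by simpa [n05] using h5
  have e3 : x 3 = 0 := by simpa [n34] using h4
  have e4 : x 4 = 0 := by simpa [e0, n34] using h3
  have e1 : x 1 = 0 := by simpa [e0, n12] using h2
  have e2 : x 2 = 0 := by simpa [e0, n12] using h1
  have e5 : x 5 = 0 := by simpa [e3, e1, e2, n05] using h0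
  ext i
  fin_cases i <;> simp [*]

/-- A triangle with a path of length two and a pendant vertex attached at different vertices has
rank six. -/
theorem six_le_rank_of_triangle_tail_pendant' {f : Fin 6 → V}
    (hf : Γ.graph.InducesPattern f [(0, 1), (0, 2), (1, 2), (0, 3), (3, 4), (1, 5)]) :
    6 ≤ Γ.adjMatrix.rank := by
  refine le_rank_of_pattern hf (by decide) fun x n h => ?_
  simp [Fin.forall_fin_succ, Fin.sum_univ_succ] at n h
  obtain ⟨n01, n02, n12, n03, n34, n15⟩ := n
  obtain ⟨h0, h1, h2, h3, h4, h5⟩ := h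
  have e1 : x 1 = 0 := by simpa [n15] using h5
  have e3 : x 3 = 0 := by simpa [n34] using h4
  have e0 : x 0 = 0 := by simpa [e1, n02] using h2
  have e2 : x 2 = 0 := by simpa [e1, e3, n02] using h0
  have e4 : x 4 = 0 := by simpa [e0, n34] using h3
  have e5 : x 5 = 0 := by simpa [e0, e2, n15] using h1
  ext i
  fin_cases i <;> simp [*]

/-- A triangle with a path of length three attached has rank six. -/
theorem six_le_rank_of_triangle_long_tail {f : Fin 6 → V}
    (hf : Γ.graph.InducesPattern f [(0, 1), (0, 2), (1, 2), (0, 3), (3, 4), (4, 5)]) :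
    6 ≤ Γ.adjMatrix.rank := by
  refine le_rank_of_pattern hf (by decide) fun x n h => ?_
  simp [Fin.forall_fin_succ, Fin.sum_univ_succ] at n h
  obtain ⟨n01, n02, n12, n03, n34, n45⟩ := n
  obtain ⟨h0, h1, h2, h3, h4, h5⟩ := h
  have e4 : x 4 = 0 := by simpa [n45] using h5
  have e0 : x 0 = 0 := by simpa [e4, n03] using h3
  have e2 : x 2 = 0 := by simpa [e0, n12] using h1
  have e1 : x 1 = 0 := by simpa [e0, n12] using h2
  have e3 : x 3 = 0 := by simpa [e2, e1, n03] using h0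
  have e5 : x 5 = 0 := by simpa [e3, n45] using h4
  ext i
  fin_cases i <;> simp [*]

end SignedGraph

/-! ### The cycle of a unicyclic graph. -/

namespace SimpleGraph

variable {V : Type*} {G : SimpleGraph V}

theorem IsUnicyclic.exists_isCycle (hG : G.IsUnicyclic) :
    ∃ (v : V) (c : G.Walk v v), c.IsCycle := by
  obtain ⟨_, H, ⟨v, c, hc, _⟩, _⟩ := hG
  exact ⟨v, c, hc⟩

theorem IsUnicyclic.toSubgraph_eq (hG : G.IsUnicyclic) {v w : V} {c : G.Walk v v}
    {d : G.Walk w w} (hc : c.IsCycle) (hd : d.IsCycle) : c.toSubgraph = d.toSubgraph :=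
  hG.2.unique ⟨v, c, hc, rfl⟩ ⟨w, d, hd, rfl⟩

theorem IsUnicyclic.mem_edges (hG : G.IsUnicyclic) {v w : V} {c : G.Walk v v}
    {d : G.Walk w w} (hc : c.IsCycle) (hd : d.IsCycle) {e : Sym2 V} (he : e ∈ d.edges) :
    e ∈ c.edges := by
  rw [← Walk.mem_edges_toSubgraph] at he ⊢
  rwa [hG.toSubgraph_eq hc hd]

theorem IsUnicyclic.mem_support (hG : G.IsUnicyclic) {v w : V} {c : G.Walk v v}
    {d : G.Walk w w} (hc : c.IsCycle) (hd : d.IsCycle) {u : V} (hu : u ∈ d.support) :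
    u ∈ c.support := by
  rw [← Walk.mem_verts_toSubgraph] at hu ⊢
  rwa [hG.toSubgraph_eq hc hd]

/-- In a unicyclic graph, two neighbours of a vertex `u` off the cycle that are joined by a walk
avoiding `u` coincide. -/
theorem IsUnicyclic.eq_of_adj_of_walk (hG : G.IsUnicyclic) {v : V} {c : G.Walk v v}
    (hc : c.IsCycle) {u x y : V} (hu : u ∉ c.support) (hx : G.Adj u x) (hy : G.Adj u y)
    (w : G.Walk x y) (hw : u ∉ w.support) : x = y := by
  classical
  by_contra hxy
  have hp : u ∉ w.bypass.support := fun h => hw (w.support_bypass_subset_support h)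
  -- Closing the path up through `u` gives a cycle containing `u`, hence a second one.
  have hcyc : (Walk.cons hx (w.bypass.concat hy.symm)).IsCycle := by
    rw [Walk.cons_isCycle_iff]
    refine ⟨w.bypass_isPath.concat hp hy.symm, fun he => ?_⟩
    rw [Walk.edges_concat, List.concat_eq_append, List.mem_append] at he
    rcases he with he | he
    · exact hp (Walk.fst_mem_support_of_mem_edges _ he)
    · simp only [List.mem_singleton, Sym2.eq_iff] at he
      rcases he with ⟨h, -⟩ | ⟨-, h⟩
      · exact hy.ne h
      · exact hxy h
  exact hu (hG.mem_support hc hcyc (by simp))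

theorem Walk.exists_walk_subset {v : V} (c : G.Walk v v) {x y : V} (hx : x ∈ c.support)
    (hy : y ∈ c.support) :
    ∃ w : G.Walk x y, w.support ⊆ c.support ∧ w.edges ⊆ c.edges := by
  classical
  refine ⟨(c.takeUntil x hx).reverse.append (c.takeUntil y hy), ?_, ?_⟩
  · intro z hz
    rw [Walk.mem_support_append_iff, Walk.support_reverse, List.mem_reverse] at hz
    rcases hz with h | h
    · exact c.support_takeUntil_subset_support _ h
    · exact c.support_takeUntil_subset_support _ h
  · intro z hz
    rw [Walk.edges_append, List.mem_append, Walk.edges_reverse, List.mem_reverse] at hz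
    rcases hz with h | h
    · exact c.edges_takeUntil_subset_edges _ h
    · exact c.edges_takeUntil_subset_edges _ h

/-- A vertex off the cycle of a unicyclic graph has at most one neighbour on the cycle. -/
theorem IsUnicyclic.eq_of_adj_cycle (hG : G.IsUnicyclic) {v : V} {c : G.Walk v v}
    (hc : c.IsCycle) {u x y : V} (hu : u ∉ c.support) (hx : G.Adj u x) (hy : G.Adj u y)
    (hxc : x ∈ c.support) (hyc : y ∈ c.support) : x = y := by
  obtain ⟨w, hw, -⟩ := c.exists_walk_subset hxc hyc
  exact hG.eq_of_adj_of_walk hc hu hx hy w fun h => hu (hw h)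

/-- The cycle of a unicyclic graph has no chord. -/
theorem IsUnicyclic.mem_edges_of_adj (hG : G.IsUnicyclic) {v : V} {c : G.Walk v v}
    (hc : c.IsCycle) {x y : V} (hxc : x ∈ c.support) (hyc : y ∈ c.support) (h : G.Adj x y) :
    s(x, y) ∈ c.edges := by
  classical
  by_contra hne
  obtain ⟨w, -, hw⟩ := c.exists_walk_subset hyc hxc
  have hcyc : (Walk.cons h w.bypass).IsCycle := by
    rw [Walk.cons_isCycle_iff]
    exact ⟨w.bypass_isPath, fun he => hne (hw (w.edges_bypass_subset_edges he))⟩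
  exact hne (hG.mem_edges hc hcyc (by simp))

theorem Walk.exists_getVert_of_mem_edges {u v : V} (p : G.Walk u v) {e : Sym2 V}
    (he : e ∈ p.edges) : ∃ i < p.length, e = s(p.getVert i, p.getVert (i + 1)) := by
  induction p with
  | nil => simp at he
  | cons h p ih =>
    rw [Walk.edges_cons, List.mem_cons] at he
    rcases he with rfl | he
    · exact ⟨0, by simp, by simp⟩
    · obtain ⟨i, hi, rfl⟩ := ih he
      exact ⟨i + 1, by simpa using hi, by simp⟩

theorem Walk.IsCycle.exists_getVert_lt {v : V} {c : G.Walk v v} (hc : c.IsCycle) {x : V}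
    (hx : x ∈ c.support) : ∃ i < c.length, c.getVert i = x := by
  have := hc.three_le_length
  obtain ⟨n, hn, hle⟩ := Walk.mem_support_iff_exists_getVert.mp hx
  rcases hle.lt_or_eq with h | h
  · exact ⟨n, h, hn⟩
  · refine ⟨0, by omega, ?_⟩
    rw [h, Walk.getVert_length] at hn
    rw [Walk.getVert_zero, hn]

/-- Adjacency between the vertices of the cycle of a unicyclic graph. -/
theorem IsUnicyclic.adj_getVert_iff (hG : G.IsUnicyclic) {v : V} {c : G.Walk v v}
    (hc : c.IsCycle) {i j : ℕ} (hij : i < j) (hj : j < c.length) :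
    G.Adj (c.getVert i) (c.getVert j) ↔ j = i + 1 ∨ i = 0 ∧ j + 1 = c.length := by
  have inj := hc.getVert_injOn'
  constructor
  · intro h
    obtain ⟨m, hm, he⟩ := c.exists_getVert_of_mem_edges
      (hG.mem_edges_of_adj hc (c.getVert_mem_support i) (c.getVert_mem_support j) h)
    have key : ∀ a b, a < c.length → b < c.length → c.getVert a = c.getVert b → a = b :=
      fun a b ha hb hab => inj (show a ≤ c.length - 1 by omega)
        (show b ≤ c.length - 1 by omega) hab
    rw [Sym2.eq_iff] at he
    by_cases hm' : m + 1 = c.length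
    · have hlast : c.getVert (m + 1) = c.getVert 0 := by
        rw [hm', Walk.getVert_length, Walk.getVert_zero]
      rw [hlast] at he
      rcases he with ⟨h1, h2⟩ | ⟨h1, h2⟩
      · have := key _ _ (by omega) (by omega) h2
        omega
      · have := key _ _ (by omega) (by omega) h1
        have := key _ _ (by omega) (by omega) h2
        omega
    · rcases he with ⟨h1, h2⟩ | ⟨h1, h2⟩
      · have := key _ _ (by omega) (by omega) h1
        have := key _ _ (by omega) (by omega) h2
        omega
      · have := key _ _ (by omega) (by omega) h1
        have := key _ _ (by omega) (by omega) h2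
        omega
  · rintro (rfl | ⟨rfl, h⟩)
    · exact c.adj_getVert_succ (by omega)
    · have := c.adj_getVert_succ hj
      rw [h, Walk.getVert_length] at this
      rw [Walk.getVert_zero]
      exact this.symm

/-- A unicyclic graph whose cycle is even is bipartite. -/
theorem IsUnicyclic.exists_coloring_of_even (hG : G.IsUnicyclic) {v : V} {c : G.Walk v v}
    (hc : c.IsCycle) (he : Even c.length) : Nonempty (G.Coloring Bool) := by
  classical
  cases c with
  | nil => exact absurd hc Walk.not_isCycle_nil
  | @cons _ w _ h p =>
    have hp := ((Walk.cons_isCycle_iff _ _).mp hc)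
    -- Removing one edge of the only cycle leaves a forest, which is 2-colourable. The rest of the
    -- cycle has odd length, so the ends of the removed edge already differ in colour.
    have hac : (G.deleteEdges {s(v, w)}).IsAcyclic := by
      intro z d hd
      have hd' := hd.mapLe (G.deleteEdges_le {s(v, w)})
      have : s(v, w) ∈ (d.mapLe (G.deleteEdges_le {s(v, w)})).edges :=
        hG.mem_edges hd' hc (by simp)
      rw [Walk.edges_mapLe_eq_edges] at this
      have := d.edges_subset_edgeSet this
      simp at this
    let f : (G.deleteEdges {s(v, w)}).Coloring Bool := hac.colorable_two.toColoring (by simp)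
    have hodd : Odd (p.toDeleteEdge s(v, w) hp.2).length := by
      rw [Walk.length_cons] at he
      simpa [Walk.toDeleteEdge, Walk.toDeleteEdges] using Nat.even_add_one.mp he
    have hne : f w ≠ f v := by
      have := (f.odd_length_iff_not_congr _).mp hodd
      intro h
      rw [h] at this
      tauto
    refine ⟨Coloring.mk f fun {x y} hxy => ?_⟩
    by_cases hxy' : s(x, y) = s(v, w)
    · rw [Sym2.eq_iff] at hxy'
      rcases hxy' with ⟨rfl, rfl⟩ | ⟨rfl, rfl⟩
      · exact hne.symm
      · exact hne
    · exact f.valid (by simpa [deleteEdges_adj, hxy] using hxy')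

theorem Preconnected.exists_adj_boundary (hG : G.Preconnected) (S : Set V) {u v : V} (hu : u ∈ S)
    (hv : v ∉ S) : ∃ x ∈ S, ∃ y ∉ S, G.Adj x y := by
  obtain ⟨d, -, h1, h2⟩ := (hG u v).some.exists_boundary_dart S hu hv
  exact ⟨d.fst, h1, d.snd, h2, d.adj⟩

end SimpleGraph

/-! ### Even, long and pentagonal cycles; the rank of the two families. -/

namespace SignedGraph

open SimpleGraph

variable {V : Type*} [Fintype V] {Γ : SignedGraph V}

theorem even_rank_of_even_cycle (hG : Γ.graph.IsUnicyclic) {v : V} {c : Γ.graph.Walk v v}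
    (hc : c.IsCycle) (he : Even c.length) : Even Γ.adjMatrix.rank := by
  classical
  obtain ⟨f⟩ := hG.exists_coloring_of_even hc he
  exact Matrix.even_rank_of_bipartite Γ.adjMatrix_transpose f fun u v huv =>
    Γ.adjMatrix_eq_zero fun h => f.valid h huv

/-- The cycle has no chord, and from length 7 on its first six vertices miss the closing edge, so
they induce a path. -/
theorem six_le_rank_of_long_cycle (hG : Γ.graph.IsUnicyclic) {v : V} {c : Γ.graph.Walk v v}
    (hc : c.IsCycle) (hl : 7 ≤ c.length) : 6 ≤ Γ.adjMatrix.rank := by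
  refine six_le_rank_of_path (f := fun i => c.getVert i) fun i j hij => ?_
  rw [hG.adj_getVert_iff hc hij (by omega)]
  have hj := j.isLt
  have h1 : ¬ ((i : ℕ) = 0 ∧ (j : ℕ) + 1 = c.length) := by omega
  simp only [h1, or_false]
  clear h1
  revert i j
  decide

theorem nonempty_iso_cycleGraph_five (hG : Γ.graph.IsUnicyclic) {v : V} {c : Γ.graph.Walk v v}
    (hc : c.IsCycle) (hl : c.length = 5) (hr : Γ.adjMatrix.rank ≤ 5) :
    Nonempty (Γ.graph ≃g cycleGraph 5) := by
  classical
  by_cases hall : ∀ u, u ∈ c.support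
  · have hinj : Function.Injective fun i : Fin 5 => c.getVert i := fun i j hij =>
      Fin.ext (hc.getVert_injOn' (show (i : ℕ) ≤ c.length - 1 by omega)
        (show (j : ℕ) ≤ c.length - 1 by omega) hij)
    have hsurj : Function.Surjective fun i : Fin 5 => c.getVert i := fun x => by
      obtain ⟨i, hi, rfl⟩ := hc.exists_getVert_lt (hall x)
      exact ⟨⟨i, by omega⟩, rfl⟩
    have hlt : ∀ i j : Fin 5, i < j →
        (Γ.graph.Adj (c.getVert i) (c.getVert j) ↔ (cycleGraph 5).Adj i j) := by
      intro i j hij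
      rw [hG.adj_getVert_iff hc hij (by omega), hl]
      revert i j
      decide
    refine ⟨(RelIso.mk (Equiv.ofBijective _ ⟨hinj, hsurj⟩) ?_ : cycleGraph 5 ≃g Γ.graph).symm⟩
    intro i j
    change Γ.graph.Adj (c.getVert i) (c.getVert j) ↔ _
    rcases lt_trichotomy i j with h | rfl | h
    · exact hlt i j h
    · simp
    · rw [adj_comm, hlt j i h, adj_comm]
  · push Not at hall
    obtain ⟨u, hu⟩ := hall
    obtain ⟨x, hx, y, hy, hxy⟩ :=
      hG.1.preconnected.exists_adj_boundary {z | z ∈ c.support} c.start_mem_support hu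
    simp only [Set.mem_ofPred_eq] at hx hy
    -- Rotate so that the attachment vertex of `y` gets index `0`; it is the only neighbour of `y`
    -- on the cycle.
    have hc' : (c.rotate x hx).IsCycle := (Walk.isCycle_rotate hx).mpr hc
    have hl' : (c.rotate x hx).length = 5 := by rw [Walk.length_rotate, hl]
    have hy' : y ∉ (c.rotate x hx).support := by rwa [Walk.mem_support_rotate_iff]
    generalize c.rotate x hx = d at hc' hl' hy'
    have hd : ∀ i j, i < j → j < 5 →
        (Γ.graph.Adj (d.getVert i) (d.getVert j) ↔ j = i + 1 ∨ i = 0 ∧ j + 1 = 5) :=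
      fun i j hij hj => by rw [hG.adj_getVert_iff hc' hij (by omega), hl']
    have hdy : ∀ i < 5, Γ.graph.Adj (d.getVert i) y ↔ i = 0 := by
      intro i hi
      constructor
      · intro h
        have := hG.eq_of_adj_cycle hc' hy' h.symm hxy.symm (d.getVert_mem_support i)
          d.start_mem_support
        exact hc'.getVert_injOn' (show i ≤ d.length - 1 by omega)
          (show 0 ≤ d.length - 1 by omega) (this.trans d.getVert_zero.symm)
      · rintro rfl
        rwa [d.getVert_zero]
    have := six_le_rank_of_pentagon_pendant (Γ := Γ)
      (f := fun i => if (i : ℕ) < 5 then d.getVert i else y) fun i j hij => by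
        have hi : (i : ℕ) < 5 := by omega
        simp only [hi, if_true]
        by_cases hj : (j : ℕ) < 5
        · simp only [hj, if_true]
          rw [hd i j hij hj]
          clear hd hdy
          revert i j
          decide
        · simp only [hj, if_false]
          rw [hdy i hi]
          clear hd hdy
          revert i j
          decide
    omega

theorem rank_eq_five_of_iso_cycleGraph (φ : Γ.graph ≃g cycleGraph 5) :
    Γ.adjMatrix.rank = 5 := by
  have h1 : 5 ≤ Γ.adjMatrix.rank := by
    refine five_le_rank_of_pentagon (f := fun i => φ.symm i) fun i j hij => ?_
    rw [φ.symm.map_adj_iff]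
    revert i j
    decide
  have h2 := Γ.adjMatrix.rank_le_card_width
  rw [Fintype.card_congr φ.toEquiv, Fintype.card_fin] at h2
  omega

theorem rank_eq_five_of_iso_U4 {r : ℕ} (hr : 1 ≤ r) (φ : Γ.graph ≃g U4 r) :
    Γ.adjMatrix.rank = 5 := by
  classical
  have h1 : 5 ≤ Γ.adjMatrix.rank := by
    refine five_le_rank_of_triangle_tail (f := fun i => φ.symm
      ((![Sum.inl 0, Sum.inl 1, Sum.inl 2, Sum.inr ⟨0, by simp⟩,
        Sum.inr ⟨⟨2, by omega⟩, by simp [Fin.ext_iff]⟩] :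
        Fin 5 → Fin 3 ⊕ {x : Fin (r + 2) // x ≠ 1}) i)) fun i j hij => ?_
    rw [φ.symm.map_adj_iff]
    fin_cases i <;> fin_cases j <;> first | (exact absurd hij (by decide)) |
      simp [U4, identifyVertex]
  -- Every edge meets the star centre or lies within the triangle, so the centre (counted twice) and
  -- the three triangle rows give `2 + 3`.
  have h2 : Γ.adjMatrix.rank ≤ 2 * ({φ.symm (Sum.inr ⟨0, by simp⟩)} : Finset V).card
      + ({φ.symm (Sum.inl 0), φ.symm (Sum.inl 1), φ.symm (Sum.inl 2)} : Finset V).card := by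
    refine Matrix.rank_le_of_cover _ _ _ fun u v huv => ?_
    have hadj : Γ.graph.Adj u v := by
      by_contra h
      exact huv (Γ.adjMatrix_eq_zero h)
    obtain ⟨s, rfl⟩ := φ.symm.surjective u
    obtain ⟨t, rfl⟩ := φ.symm.surjective v
    rw [φ.symm.map_adj_iff] at hadj
    simp only [Finset.mem_singleton, Finset.mem_insert, EmbeddingLike.apply_eq_iff_eq]
    rcases s with i | x
    · right
      right
      fin_cases i <;> simp
    · rcases t with i | y
      · simp only [U4, identifyVertex, starGraph_adj] at hadj
        left
        rw [Sum.inr.injEq, Subtype.ext_iff]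
        rcases hadj.2.2 with h | h
        · simp at h
        · exact h
      · simp only [U4, identifyVertex, starGraph_adj] at hadj
        rw [Sum.inr.injEq, Subtype.ext_iff, Sum.inr.injEq, Subtype.ext_iff]
        tauto
  have h3 : ({φ.symm (Sum.inl 0), φ.symm (Sum.inl 1), φ.symm (Sum.inl 2)} : Finset V).card ≤ 3 :=
    Finset.card_le_three
  rw [Finset.card_singleton] at h2
  omega

end SignedGraph

/-! ### Recognising `U4 r`. -/

namespace SimpleGraph

variable {V : Type*} {G : SimpleGraph V}

theorem exists_iso_U4 [Fintype V] {a b c v w : V} (hab : G.Adj a b) (hac : G.Adj a c)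
    (hbc : G.Adj b c) (hav : G.Adj a v) (hbv : ¬ G.Adj b v) (hcv : ¬ G.Adj c v)
    (hw : w ≠ a ∧ w ≠ b ∧ w ≠ c ∧ w ≠ v)
    (hv : ∀ u, u ≠ a ∧ u ≠ b ∧ u ≠ c ∧ u ≠ v → ∀ x, G.Adj u x ↔ x = v) :
    ∃ r : ℕ, 1 ≤ r ∧ Nonempty (G ≃g U4 r) := by
  classical
  have hvec : Function.Injective ![a, b, c] := by
    intro i j h
    fin_cases i <;> fin_cases j <;> first
      | rfl
      | exact absurd h hab.ne
      | exact absurd h hac.ne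
      | exact absurd h hbc.ne
      | exact absurd h hab.ne'
      | exact absurd h hac.ne'
      | exact absurd h hbc.ne'
  -- `W` holds the leaves of the star centred at `v` other than `a`. They are interchangeable, so
  -- any bijection onto the remaining star indices serves.
  let W := {u : V // u ≠ a ∧ u ≠ b ∧ u ≠ c ∧ u ≠ v}
  refine ⟨Fintype.card W, Fintype.card_pos_iff.mpr ⟨⟨w, hw⟩⟩, ?_⟩
  set r := Fintype.card W with hr
  have hcard : Fintype.card {x : Fin (r + 2) // x ≠ 1 ∧ x ≠ 0} = Fintype.card W := by
    rw [Fintype.card_subtype]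
    have : (Finset.univ.filter fun x : Fin (r + 2) => x ≠ 1 ∧ x ≠ 0) =
        Finset.univ \ {0, 1} := by
      ext x
      simp only [Finset.mem_filter, Finset.mem_univ, Finset.mem_sdiff, Finset.mem_insert,
        Finset.mem_singleton]
      tauto
    rw [this, Finset.card_sdiff_of_subset (Finset.subset_univ _), Finset.card_pair (by simp)]
    simp [hr]
  let e : {x : Fin (r + 2) // x ≠ 1 ∧ x ≠ 0} ≃ W := Fintype.equivOfCardEq hcard
  have hva : v ≠ a := hav.ne'
  have hvb : v ≠ b := by rintro rfl; exact hcv hbc.symm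
  have hvc : v ≠ c := by rintro rfl; exact hbv hbc
  let g : Fin 3 ⊕ {x : Fin (r + 2) // x ≠ 1} → V :=
    Sum.elim ![a, b, c] fun x => if h : x.1 = 0 then v else (e ⟨x.1, x.2, h⟩).1
  have g0 : g (Sum.inl 0) = a := rfl
  have g1 : g (Sum.inl 1) = b := rfl
  have g2 : g (Sum.inl 2) = c := rfl
  have gv : ∀ x : {x : Fin (r + 2) // x ≠ 1}, x.1 = 0 → g (Sum.inr x) = v := fun x h => by
    simp [g, h]
  have ge : ∀ (x : {x : Fin (r + 2) // x ≠ 1}) (h : x.1 ≠ 0),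
      g (Sum.inr x) = (e ⟨x.1, x.2, h⟩).1 := fun x h => by simp [g, h]
  have gW : ∀ (x : {x : Fin (r + 2) // x ≠ 1}), x.1 ≠ 0 → g (Sum.inr x) ≠ a ∧
      g (Sum.inr x) ≠ b ∧ g (Sum.inr x) ≠ c ∧ g (Sum.inr x) ≠ v := fun x h => by
    rw [ge x h]
    exact (e ⟨x.1, x.2, h⟩).2
  have hlr : ∀ i x, g (Sum.inl i) ≠ g (Sum.inr x) := by
    intro i x
    by_cases h : x.1 = 0
    · rw [gv x h]
      fin_cases i
      exacts [hva.symm, hvb.symm, hvc.symm]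
    · obtain ⟨h1, h2, h3, -⟩ := gW x h
      fin_cases i
      exacts [h1.symm, h2.symm, h3.symm]
  have hinj : Function.Injective g := by
    rintro (i | x) (j | y) h
    · exact congrArg Sum.inl (hvec h)
    · exact absurd h (hlr i y)
    · exact absurd h.symm (hlr j x)
    · congr 1
      by_cases hx : x.1 = 0 <;> by_cases hy : y.1 = 0
      · exact Subtype.ext (hx.trans hy.symm)
      · rw [gv x hx] at h
        exact absurd h.symm (gW y hy).2.2.2
      · rw [gv y hy] at h
        exact absurd h (gW x hx).2.2.2
      · rw [ge x hx, ge y hy] at h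
        have := congrArg (fun z => z.1) (e.injective (Subtype.ext h))
        exact Subtype.ext this
  have hsurj : Function.Surjective g := by
    intro u
    by_cases hu : u ≠ a ∧ u ≠ b ∧ u ≠ c ∧ u ≠ v
    · let z := e.symm ⟨u, hu⟩
      refine ⟨Sum.inr ⟨z.1, z.2.1⟩, ?_⟩
      rw [ge _ z.2.2]
      change (e (e.symm ⟨u, hu⟩)).1 = u
      rw [e.apply_symm_apply]
    · simp only [ne_eq, not_and_or, not_not] at hu
      rcases hu with rfl | rfl | rfl | rfl
      · exact ⟨_, g0⟩
      · exact ⟨_, g1⟩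
      · exact ⟨_, g2⟩
      · exact ⟨_, gv ⟨0, by simp⟩ rfl⟩
  have hone : ∀ x : {x : Fin (r + 2) // x ≠ 1}, (starGraph (0 : Fin (r + 2))).Adj 1 x ↔
      x.1 = 0 := fun x => by
    have := x.2
    rw [starGraph_adj]
    simp [this.symm]
  have hadj_lr : ∀ i x, G.Adj (g (Sum.inl i)) (g (Sum.inr x)) ↔ i = 0 ∧ x.1 = 0 := by
    intro i x
    by_cases h : x.1 = 0
    · rw [gv x h]
      fin_cases i
      · simpa [g0, h] using hav
      · simpa [g1] using hbv
      · simpa [g2] using hcv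
    · simp only [h, and_false, iff_false]
      rw [adj_comm, hv _ (gW x h)]
      have := hlr i ⟨0, by simp⟩
      rwa [gv _ rfl] at this
  refine ⟨(RelIso.mk (Equiv.ofBijective g ⟨hinj, hsurj⟩) ?_ : U4 r ≃g G).symm⟩
  intro s t
  change G.Adj (g s) (g t) ↔ _
  rcases s with i | x <;> rcases t with j | y
  · change _ ↔ (completeGraph (Fin 3)).Adj i j
    fin_cases i <;> fin_cases j <;> simp [g, hab, hac, hbc, hab.symm, hac.symm, hbc.symm]
  · change _ ↔ i = 0 ∧ (starGraph (0 : Fin (r + 2))).Adj 1 y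
    rw [hadj_lr, hone]
  · change _ ↔ j = 0 ∧ (starGraph (0 : Fin (r + 2))).Adj 1 x
    rw [adj_comm, hadj_lr, hone]
  · change _ ↔ (starGraph (0 : Fin (r + 2))).Adj x.1 y.1
    rw [starGraph_adj]
    by_cases hx : x.1 = 0
    · by_cases hy : y.1 = 0
      · simp [gv x hx, gv y hy, hx, hy]
      · rw [adj_comm, hv _ (gW y hy), gv x hx]
        simp [hx, Ne.symm hy]
    · rw [hv _ (gW x hx)]
      by_cases hy : y.1 = 0
      · simp [gv y hy, hx, hy]
      · simp [hx, hy, (gW y hy).2.2.2]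

end SimpleGraph

/-! ### The triangle case. -/

namespace SignedGraph

variable {V : Type*} [Fintype V] {Γ : SignedGraph V}

/-- Here `hout` encodes that no cycle passes through a vertex off the triangle. It mentions only the
three corners, so that they can be permuted. -/
theorem exists_iso_U4_of_tail {a b c v w : V} (hconn : Γ.graph.Preconnected)
    (hab : Γ.graph.Adj a b) (hac : Γ.graph.Adj a c) (hbc : Γ.graph.Adj b c)
    (hout : ∀ u, u ≠ a → u ≠ b → u ≠ c → ∀ x y, Γ.graph.Adj x u → Γ.graph.Adj y u → x ≠ y →
      ∀ p : Γ.graph.Walk x y, u ∈ p.support)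
    (hav : Γ.graph.Adj a v) (hvb : v ≠ b) (hvc : v ≠ c)
    (hvw : Γ.graph.Adj v w) (hwa : w ≠ a) (hwb : w ≠ b) (hwc : w ≠ c)
    (hr : Γ.adjMatrix.rank ≤ 5) :
    ∃ r : ℕ, 1 ≤ r ∧ Nonempty (Γ.graph ≃g SimpleGraph.U4 r) := by
  have hva := hav.ne'
  -- `out1`, `out2` and `out3` forbid cycles of length 3, 4 and 5 through `u`; they supply the
  -- non-edges of the induced patterns.
  have out1 : ∀ {u x y}, u ≠ a → u ≠ b → u ≠ c → Γ.graph.Adj x y → Γ.graph.Adj x u →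
      ¬ Γ.graph.Adj y u := by
    intro u x y h1 h2 h3 hxy hx hy
    have := hout u h1 h2 h3 x y hx hy hxy.ne hxy.toWalk
    simp [hx.ne', hy.ne'] at this
  have out2 : ∀ {u x y}, u ≠ a → u ≠ b → u ≠ c → ∀ z, Γ.graph.Adj x z → Γ.graph.Adj z y →
      u ≠ z → x ≠ y → Γ.graph.Adj x u → ¬ Γ.graph.Adj y u := by
    intro u x y h1 h2 h3 z hxz hzy hz hne hx hy
    have := hout u h1 h2 h3 x y hx hy hne (.cons hxz (.cons hzy .nil))
    simp [hx.ne', hy.ne', hz] at this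
  have out3 : ∀ {u x y}, u ≠ a → u ≠ b → u ≠ c → ∀ z z', Γ.graph.Adj x z → Γ.graph.Adj z z' →
      Γ.graph.Adj z' y → u ≠ z → u ≠ z' → x ≠ y → Γ.graph.Adj x u → ¬ Γ.graph.Adj y u := by
    intro u x y h1 h2 h3 z z' hxz hzz hzy hz hz' hne hx hy
    have := hout u h1 h2 h3 x y hx hy hne (.cons hxz (.cons hzz (.cons hzy .nil)))
    simp [hx.ne', hy.ne', hz, hz'] at this
  have hbv : ¬ Γ.graph.Adj b v := out1 hva hvb hvc hab hav
  have hcv : ¬ Γ.graph.Adj c v := out1 hva hvb hvc hac hav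
  have htail : ∀ {z}, z ≠ a → z ≠ b → z ≠ c → Γ.graph.Adj v z →
      ¬ Γ.graph.Adj a z ∧ ¬ Γ.graph.Adj b z ∧ ¬ Γ.graph.Adj c z := fun h1 h2 h3 h =>
    ⟨out1 h1 h2 h3 hav.symm h, out2 h1 h2 h3 a hav.symm hab h1 hvb h,
      out2 h1 h2 h3 a hav.symm hac h1 hvc h⟩
  have hlong : ∀ z u, z ≠ a → z ≠ b → z ≠ c → Γ.graph.Adj v z → u ≠ a → u ≠ b → u ≠ c →
      u ≠ v → ¬ Γ.graph.Adj z u := by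
    intro z u za zb zc hvz ua ub uc uv hzu
    obtain ⟨t1, t2, t3⟩ := htail za zb zc hvz
    have h1 : ¬ Γ.graph.Adj v u := out1 ua ub uc hvz.symm hzu
    have h2 : ¬ Γ.graph.Adj a u := out2 ua ub uc v hvz.symm hav.symm uv za hzu
    have h3 : ¬ Γ.graph.Adj b u := out3 ua ub uc v a hvz.symm hav.symm hab uv ua zb hzu
    have h4 : ¬ Γ.graph.Adj c u := out3 ua ub uc v a hvz.symm hav.symm hac uv ua zc hzu
    have := six_le_rank_of_triangle_long_tail (Γ := Γ) (f := ![a, b, c, v, z, u]) (by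
      simp [SimpleGraph.InducesPattern, Fin.forall_fin_succ, *])
    omega
  obtain ⟨haw, hbw, hcw⟩ := htail hwa hwb hwc hvw
  -- Together with the tail `a`, `v`, `w`, another vertex attached to the triangle would induce a
  -- graph of rank 6.
  have hT : ∀ u, u ≠ a → u ≠ b → u ≠ c → u ≠ v →
      ¬ Γ.graph.Adj a u ∧ ¬ Γ.graph.Adj b u ∧ ¬ Γ.graph.Adj c u := by
    intro u ua ub uc uv
    by_cases uw : u = w
    · subst uw
      exact ⟨haw, hbw, hcw⟩
    have hwu := hlong w u hwa hwb hwc hvw ua ub uc uv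
    refine ⟨fun h => ?_, fun h => ?_, fun h => ?_⟩
    · have h1 : ¬ Γ.graph.Adj b u := out1 ua ub uc hab h
      have h2 : ¬ Γ.graph.Adj c u := out1 ua ub uc hac h
      have h3 : ¬ Γ.graph.Adj v u := out1 ua ub uc hav h
      have := six_le_rank_of_triangle_tail_pendant (Γ := Γ) (f := ![a, b, c, v, w, u]) (by
        simp [SimpleGraph.InducesPattern, Fin.forall_fin_succ, *])
      omega
    · have h1 : ¬ Γ.graph.Adj a u := out1 ua ub uc hab.symm h
      have h2 : ¬ Γ.graph.Adj c u := out1 ua ub uc hbc h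
      have h3 : ¬ Γ.graph.Adj v u := out2 ua ub uc a hab.symm hav ua hvb.symm h
      have := six_le_rank_of_triangle_tail_pendant' (Γ := Γ) (f := ![a, b, c, v, w, u]) (by
        simp [SimpleGraph.InducesPattern, Fin.forall_fin_succ, *])
      omega
    · have h1 : ¬ Γ.graph.Adj a u := out1 ua ub uc hac.symm h
      have h2 : ¬ Γ.graph.Adj b u := out1 ua ub uc hbc.symm h
      have h3 : ¬ Γ.graph.Adj v u := out2 ua ub uc a hac.symm hav ua hvc.symm h
      have hcb := hbc.symm
      have := six_le_rank_of_triangle_tail_pendant' (Γ := Γ) (f := ![a, c, b, v, w, u]) (by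
        simp [SimpleGraph.InducesPattern, Fin.forall_fin_succ, *])
      omega
  -- By `hT` and `hlong` no edge leaves the set formed by the triangle, `v` and the neighbours of
  -- `v`; connectedness makes it everything.
  have hall : ∀ u, u ≠ a → u ≠ b → u ≠ c → u ≠ v → Γ.graph.Adj v u := by
    by_contra! hne
    obtain ⟨u, ua, ub, uc, uv, hvu⟩ := hne
    obtain ⟨x, hx, y, hy, hxy⟩ := hconn.exists_adj_boundary
      {z | z = a ∨ z = b ∨ z = c ∨ z = v ∨ Γ.graph.Adj v z} (u := a) (v := u)
      (Or.inl rfl) (by simp [*])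
    simp only [Set.mem_ofPred_eq, not_or] at hx hy
    obtain ⟨ya, yb, yc, yv, hvy⟩ := hy
    obtain ⟨t1, t2, t3⟩ := hT y ya yb yc yv
    by_cases hxT : x = a ∨ x = b ∨ x = c
    · rcases hxT with rfl | rfl | rfl
      exacts [t1 hxy, t2 hxy, t3 hxy]
    · simp only [not_or] at hxT
      obtain ⟨xa, xb, xc⟩ := hxT
      rcases hx with h | h | h | rfl | h
      · exact xa h
      · exact xb h
      · exact xc h
      · exact hvy hxy
      · exact hlong x y xa xb xc h ya yb yc yv hxy
  refine SimpleGraph.exists_iso_U4 hab hac hbc hav hbv hcv ⟨hwa, hwb, hwc, hvw.ne'⟩ ?_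
  rintro u ⟨ua, ub, uc, uv⟩ x
  refine ⟨fun h => ?_, ?_⟩
  · by_contra xv
    obtain ⟨t1, t2, t3⟩ := hT u ua ub uc uv
    refine hlong u x ua ub uc (hall u ua ub uc uv) ?_ ?_ ?_ xv h
    · rintro rfl
      exact t1 h.symm
    · rintro rfl
      exact t2 h.symm
    · rintro rfl
      exact t3 h.symm
  · rintro rfl
    exact (hall u ua ub uc uv).symm

theorem rank_ne_five_of_no_tail {a b c : V} (hconn : Γ.graph.Preconnected)
    (hab : Γ.graph.Adj a b) (hac : Γ.graph.Adj a c) (hbc : Γ.graph.Adj b c)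
    (hout : ∀ u, u ≠ a → u ≠ b → u ≠ c → ∀ x y, Γ.graph.Adj x u → Γ.graph.Adj y u → x ≠ y →
      ∀ p : Γ.graph.Walk x y, u ∈ p.support)
    (htail : ∀ x v w, (x = a ∨ x = b ∨ x = c) → Γ.graph.Adj x v → v ≠ a → v ≠ b → v ≠ c →
      Γ.graph.Adj v w → w = a ∨ w = b ∨ w = c) :
    Γ.adjMatrix.rank ≠ 5 := by
  classical
  have hall : ∀ v, v ≠ a → v ≠ b → v ≠ c →
      Γ.graph.Adj a v ∨ Γ.graph.Adj b v ∨ Γ.graph.Adj c v := by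
    by_contra! hne
    obtain ⟨u, ua, ub, uc, h1, h2, h3⟩ := hne
    obtain ⟨x, hx, y, hy, hxy⟩ := hconn.exists_adj_boundary
      {z | (z = a ∨ z = b ∨ z = c) ∨ Γ.graph.Adj a z ∨ Γ.graph.Adj b z ∨ Γ.graph.Adj c z}
      (u := a) (v := u) (Or.inl (Or.inl rfl)) (by simp [*])
    simp only [Set.mem_ofPred_eq, not_or] at hx hy
    obtain ⟨⟨ya, yb, yc⟩, k1, k2, k3⟩ := hy
    by_cases hxT : x = a ∨ x = b ∨ x = c
    · rcases hxT with rfl | rfl | rfl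
      exacts [k1 hxy, k2 hxy, k3 hxy]
    · have hx' := hx.resolve_left hxT
      simp only [not_or] at hxT
      obtain ⟨xa, xb, xc⟩ := hxT
      have : y = a ∨ y = b ∨ y = c := by
        rcases hx' with h | h | h
        · exact htail a x y (by simp) h xa xb xc hxy
        · exact htail b x y (by simp) h xa xb xc hxy
        · exact htail c x y (by simp) h xa xb xc hxy
      tauto
  have hnbr : ∀ v w, Γ.graph.Adj v w → v ≠ a → v ≠ b → v ≠ c → w = a ∨ w = b ∨ w = c := by
    intro v w hvw va vb vc
    rcases hall v va vb vc with h | h | h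
    · exact htail a v w (by simp) h va vb vc hvw
    · exact htail b v w (by simp) h va vb vc hvw
    · exact htail c v w (by simp) h va vb vc hvw
  -- If the corner `z` has no neighbour outside the triangle, every edge meets `{x, y}`.
  have hcover : ∀ x y z, ({x, y, z} : Set V) = {a, b, c} →
      (∀ v, Γ.graph.Adj z v → v = a ∨ v = b ∨ v = c) → Γ.adjMatrix.rank ≤ 4 := by
    intro x y z hxyz hz
    have hmem : ∀ v, (v = a ∨ v = b ∨ v = c) ↔ (v = x ∨ v = y ∨ v = z) := by
      intro v
      have := Set.ext_iff.mp hxyz v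
      simp only [Set.mem_insert_iff, Set.mem_singleton_iff] at this
      exact this.symm
    have h1 := Matrix.rank_le_of_cover Γ.adjMatrix {x, y} ∅ (fun u v huv => by
      have hadj : Γ.graph.Adj u v := by
        by_contra h
        exact huv (Γ.adjMatrix_eq_zero h)
      simp only [Finset.mem_insert, Finset.mem_singleton, Finset.notMem_empty, or_false]
      by_cases hu : u = a ∨ u = b ∨ u = c
      · rcases (hmem u).mp hu with h | h | rfl
        · exact Or.inl (Or.inl h)
        · exact Or.inl (Or.inr h)
        · rcases (hmem v).mp (hz v hadj) with h | h | h
          · exact Or.inr (Or.inl h)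
          · exact Or.inr (Or.inr h)
          · exact absurd h.symm hadj.ne
      · have hv := hnbr u v hadj (by tauto) (by tauto) (by tauto)
        rcases (hmem v).mp hv with h | h | rfl
        · exact Or.inr (Or.inl h)
        · exact Or.inr (Or.inr h)
        · exact absurd (hz u hadj.symm) hu)
    have h2 : ({x, y} : Finset V).card ≤ 2 := Finset.card_le_two
    rw [Finset.card_empty] at h1
    omega
  by_cases ha : ∀ v, Γ.graph.Adj a v → v = a ∨ v = b ∨ v = c
  · have := hcover b c a (by ext; simp; tauto) ha
    omega
  by_cases hb : ∀ v, Γ.graph.Adj b v → v = a ∨ v = b ∨ v = c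
  · have := hcover a c b (by ext; simp; tauto) hb
    omega
  by_cases hc : ∀ v, Γ.graph.Adj c v → v = a ∨ v = b ∨ v = c
  · have := hcover a b c rfl hc
    omega
  -- Now each corner has an outside neighbour, and these three complete the triangle to an induced
  -- net.
  simp only [not_forall, not_or] at ha hb hc
  obtain ⟨p, hap, pa, pb, pc⟩ := ha
  obtain ⟨q, hbq, qa, qb, qc⟩ := hb
  obtain ⟨s, hcs, sa, sb, sc⟩ := hc
  have out1 : ∀ {u x y}, u ≠ a → u ≠ b → u ≠ c → Γ.graph.Adj x y → Γ.graph.Adj x u →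
      ¬ Γ.graph.Adj y u := by
    intro u x y h1 h2 h3 hxy hx hy
    have := hout u h1 h2 h3 x y hx hy hxy.ne hxy.toWalk
    simp [hx.ne', hy.ne'] at this
  have h1 := out1 pa pb pc hab hap
  have h2 := out1 pa pb pc hac hap
  have h3 := out1 qa qb qc hab.symm hbq
  have h4 := out1 qa qb qc hbc hbq
  have h5 := out1 sa sb sc hac.symm hcs
  have h6 := out1 sa sb sc hbc.symm hcs
  have h7 : ¬ Γ.graph.Adj p q := fun h => by have := hnbr p q h pa pb pc; tauto
  have h8 : ¬ Γ.graph.Adj p s := fun h => by have := hnbr p s h pa pb pc; tauto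
  have h9 : ¬ Γ.graph.Adj q s := fun h => by have := hnbr q s h qa qb qc; tauto
  have := six_le_rank_of_net (Γ := Γ) (f := ![a, b, c, p, q, s]) (by
    simp [SimpleGraph.InducesPattern, Fin.forall_fin_succ, *])
  omega

theorem exists_iso_U4_of_triangle (hG : Γ.graph.IsUnicyclic) {v : V} {c : Γ.graph.Walk v v}
    (hc : c.IsCycle) (hl : c.length = 3) (hr : Γ.adjMatrix.rank = 5) :
    ∃ r : ℕ, 1 ≤ r ∧ Nonempty (Γ.graph ≃g SimpleGraph.U4 r) := by
  have h01 : Γ.graph.Adj (c.getVert 0) (c.getVert 1) :=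
    (hG.adj_getVert_iff hc (by omega) (by omega)).mpr (by omega)
  have h02 : Γ.graph.Adj (c.getVert 0) (c.getVert 2) :=
    (hG.adj_getVert_iff hc (by omega) (by omega)).mpr (by omega)
  have h12 : Γ.graph.Adj (c.getVert 1) (c.getVert 2) :=
    (hG.adj_getVert_iff hc (by omega) (by omega)).mpr (by omega)
  have hout : ∀ u, u ≠ c.getVert 0 → u ≠ c.getVert 1 → u ≠ c.getVert 2 → ∀ x y,
      Γ.graph.Adj x u → Γ.graph.Adj y u → x ≠ y → ∀ p : Γ.graph.Walk x y, u ∈ p.support := by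
    intro u h0 h1 h2 x y hx hy hxy p
    by_contra hp
    refine hxy (hG.eq_of_adj_of_walk hc (fun hu => ?_) hx.symm hy.symm p hp)
    obtain ⟨i, hi, rfl⟩ := hc.exists_getVert_lt hu
    rw [hl] at hi
    interval_cases i <;> contradiction
  generalize c.getVert 0 = x at *
  generalize c.getVert 1 = y at *
  generalize c.getVert 2 = z at *
  -- Failing `U4 r`, no corner carries a tail: a tail at any corner is moved to the first position
  -- by relabelling.
  by_contra hne
  refine rank_ne_five_of_no_tail hG.1.preconnected h01 h02 h12 hout ?_ hr
  intro t v w ht htv vx vy vz hvw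
  by_contra hw
  simp only [not_or] at hw
  obtain ⟨wx, wy, wz⟩ := hw
  apply hne
  rcases ht with rfl | rfl | rfl
  · exact exists_iso_U4_of_tail hG.1.preconnected h01 h02 h12 hout htv vy vz hvw wx wy wz hr.le
  · exact exists_iso_U4_of_tail hG.1.preconnected h01.symm h12 h02
      (fun u h1 h2 h3 => hout u h2 h1 h3) htv vx vz hvw wy wx wz hr.le
  · exact exists_iso_U4_of_tail hG.1.preconnected h02.symm h12.symm h01
      (fun u h1 h2 h3 => hout u h2 h3 h1) htv vx vy hvw wz wx wy hr.le

end SignedGraph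

/-! ### The classification, by the length of the cycle. -/

theorem mainTheorem3 {V : Type*} [Fintype V] [DecidableEq V] (Γ : SignedGraph V)
    (hΓ : Γ.graph.IsUnicyclic) (hn : 5 ≤ Fintype.card V) :
    Γ.nullity = Fintype.card V - 5 ↔
      Nonempty (Γ.graph ≃g SimpleGraph.cycleGraph 5) ∨
        ∃ r : ℕ, 1 ≤ r ∧ Nonempty (Γ.graph ≃g SimpleGraph.U4 r) := by
  rw [Γ.nullity_eq_card_sub_five_iff hn]
  constructor
  · intro hr
    obtain ⟨v, c, hc⟩ := hΓ.exists_isCycle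
    have h3 := hc.three_le_length
    have hodd : ¬ Even c.length := fun he => by
      have := SignedGraph.even_rank_of_even_cycle hΓ hc he
      rw [hr] at this
      exact absurd this (by decide)
    have h7 : c.length < 7 := by
      by_contra h
      have := SignedGraph.six_le_rank_of_long_cycle hΓ hc (by omega)
      omega
    rw [Nat.not_even_iff] at hodd
    have h35 : c.length = 3 ∨ c.length = 5 := by omega
    rcases h35 with h | h
    · exact Or.inr (SignedGraph.exists_iso_U4_of_triangle hΓ hc h hr)
    · exact Or.inl (SignedGraph.nonempty_iso_cycleGraph_five hΓ hc h hr.le)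
  · rintro (⟨⟨φ⟩⟩ | ⟨r, hr, ⟨φ⟩⟩)
    · exact SignedGraph.rank_eq_five_of_iso_cycleGraph φ
    · exact SignedGraph.rank_eq_five_of_iso_U4 hr φ
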